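/- Let $\mathcal X,\mathcal Y$ be finite non-empty alphabets, let $\mathcal P(\cdot)$ denote the set of probability distributions on a finite set, and let $W:\mathcal X\to\mathcal Y$ be a classical channel, i.e. a stochastic matrix $W(y|x)$, with $W^{\otimes n}(y^n|x^n)=\prod_{i=1}^n W(y_i|x_i)$ and $W_{\min}=\min\{W(y|x): W(y|x)>0\}$. All logarithms are natural. For distributions $p,q$ on a finite set let $P(p,q)=\sqrt{1-\big(\sum_y\sqrt{p(y)q(y)}\big)^2}$ be the purified distance, and for channels $V,\widetilde V:\mathcal A\to\mathcal B$ let $P(V,\widetilde V)=\max_{a} P(V(\cdot|a),\widetilde V(\cdot|a))$. For a real number $M\ge 1$, the optimal non-signaling assisted simulation error of a channel $V:\mathcal A\to\mathcal B$ with communication size $M$ is $$\epsilon^{\mathrm{NS}}(V,M)=\inf\Big\{P(V,\widetilde V)\;:\;\widetilde V:\mathcal A\to\mathcal B\text{ a channel},\ q\in\mathcal P(\mathcal B),\ \widetilde V(b|a)\le M\,q(b)\ \ \forall a\in\mathcal A,\,b\in\mathcal B\Big\}.$$ For $\alpha\in(0,1)$ let $D_\alpha(p\|q)=\frac{1}{\alpha-1}\log\sum_y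 p(y)^\alpha q(y)^{1-\alpha}$ (equal to $+\infty$ if $p$ and $q$ have disjoint supports), and let $D_1(p\|q)=D(p\|q)$ be the relative entropy ($+\infty$ unless $\operatorname{supp}p\subseteq\operatorname{supp}q$); we use $0\cdot\infty=0$ and $e^{-\infty}=0$. For $r\ge 0$ and $n\in\mathbb N$ put $$E_n(W,r)=\inf_{\frac12\le\alpha\le1}\ \inf_{p_X\in\mathcal P(\mathcal X)}\ \sup_{q_Y\in\mathcal P(\mathcal Y)}\exp\Big(-n\,\tfrac{1-\alpha}{\alpha}\big(\mathbb E_{x\sim p_X}D_\alpha(W(\cdot|x)\|q_Y)-r\big)\Big).$$ (1) For all $r\ge 0$, $\eta>0$ and $n\in\mathbb N$, $$1-\epsilon^{\mathrm{NS}}(W^{\otimes n},e^{nr})\ \ge\ \frac{\gamma_n^2}{8}\,e^{-4\sqrt{A(\eta,W)\,n}}\,(1+\eta|\mathcal Y|)^{-n}\,E_n(W,r),$$ where $\gamma_n=(n+1)^{-|\mathcal X|}$ and $A(\eta,W)=2\log^2|\mathcal Y|+\max\big\{\log^2 W_{\min},\ \log^2\tfrac{\eta}{1+\eta|\mathcal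 Y|}\big\}+4$. (2) Consequently (take $\eta=1/n$) there is a constant $C>0$ depending only on $W$ such that, for all $r\ge0$ and all $n\ge 2$, $$1-\epsilon^{\mathrm{NS}}(W^{\otimes n},e^{nr})\ \ge\ e^{-C\sqrt n\,\log n}\,E_n(W,r).$$ -/

import Mathlib

open scoped ENNReal

noncomputable section

namespace ChannelSim

/-- `W x y` is the transition probability `W(y|x)`; a classical channel is a stochastic matrix. -/
def IsChannel {X Y : Type*} [Fintype Y] (W : X → Y → ℝ) : Prop :=
  ∀ x, W x ∈ stdSimplex ℝ Y

/-- The `n`-fold product channel `W^{⊗n}(yⁿ|xⁿ) = ∏ᵢ W(yᵢ|xᵢ)`. -/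
def tensorPower {X Y : Type*} (W : X → Y → ℝ) (n : ℕ) : (Fin n → X) → (Fin n → Y) → ℝ :=
  fun x y => ∏ i, W (x i) (y i)

/-- The fidelity `(∑ √p √q)²` of two distributions. -/
def fidelity {Y : Type*} [Fintype Y] (p q : Y → ℝ) : ℝ :=
  (∑ y, √(p y) * √(q y)) ^ 2

/-- The purified distance `√(1 - F)` of two distributions. -/
def purifiedDist {Y : Type*} [Fintype Y] (p q : Y → ℝ) : ℝ :=
  √(1 - fidelity p q)

/-- The channel purified distance; for a finite nonempty `X` the supremum is a maximum. -/
def channelPurifiedDist {X Y : Type*} [Fintype Y] (W V : X → Y → ℝ) : ℝ :=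
  ⨆ x, purifiedDist (W x) (V x)

/-- The optimal non-signaling simulation error `ε^NS(W, M)` of real communication size `M`: the
infimum of the channel purified distance over channels `V` and distributions `q` on `Y` with
`V(y|x) ≤ M q(y)`. Some pair `(V, q)` is admissible whenever `M ≥ 1` and `Y` is nonempty. -/
def nsError {X Y : Type*} [Fintype Y] (W : X → Y → ℝ) (M : ℝ) : ℝ :=
  sInf {e : ℝ | ∃ (V : X → Y → ℝ) (q : Y → ℝ), IsChannel V ∧ q ∈ stdSimplex ℝ Y ∧
    (∀ x y, V x y ≤ M * q y) ∧ e = channelPurifiedDist W V}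

open Classical in
/-- The Kullback–Leibler divergence of finite distributions, in nats, with values in `EReal`. -/
def klDiv {Y : Type*} [Fintype Y] (p q : Y → ℝ) : EReal :=
  if ∀ y, q y = 0 → p y = 0 then ((∑ y, p y * Real.log (p y / q y) : ℝ) : EReal) else ⊤

open Classical in
/-- The Rényi divergence of order `α > 0`, with `D₁ = D`. The logarithm is `EReal`-valued with
`log 0 = -∞`, so that `D_α = +∞` when `α < 1` and the supports are disjoint. -/
def renyiDiv {Y : Type*} [Fintype Y] (α : ℝ) (p q : Y → ℝ) : EReal :=
  if α = 1 then klDiv p q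
  else if α < 1 ∨ ∀ y, q y = 0 → p y = 0 then
    ((1 / (α - 1) : ℝ) : EReal) *
      ENNReal.log (ENNReal.ofReal (∑ y, p y ^ α * q y ^ (1 - α)))
  else ⊤

/-- The smallest nonzero transition probability of `W`. -/
def minProb {X Y : Type*} (W : X → Y → ℝ) : ℝ :=
  sInf {w : ℝ | ∃ x y, W x y = w ∧ 0 < w}

/-- `A(η, W) = 2 log²|Y| + max {log² W_min, log² (η / (1 + η|Y|))} + 4`. -/
def constA {X Y : Type*} [Fintype Y] (η : ℝ) (W : X → Y → ℝ) : ℝ :=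
  2 * Real.log (Fintype.card Y) ^ 2 +
    max (Real.log (minProb W) ^ 2) (Real.log (η / (1 + η * Fintype.card Y)) ^ 2) + 4

/-- `γ_n = (n+1)^{-|X|}`. -/
def gammaN (X : Type*) [Fintype X] (n : ℕ) : ℝ :=
  (((n : ℝ) + 1) ^ Fintype.card X)⁻¹

/-- `inf_{1/2 ≤ α ≤ 1} inf_{p ∈ P(X)} sup_{q ∈ P(Y)}
exp (- n (1-α)/α (E_{x∼p} D_α(W(·|x) ‖ q) - r))`. The exponent is computed in `EReal`
(where `0 * ⊤ = 0` and `exp (-∞) = 0`) and the value lies in `[0, ∞]`. -/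
def optExp {X Y : Type*} [Fintype X] [Fintype Y] (W : X → Y → ℝ) (n : ℕ) (r : ℝ) : ℝ≥0∞ :=
  ⨅ α ∈ Set.Icc (1 / 2 : ℝ) 1, ⨅ p ∈ stdSimplex ℝ X, ⨆ q ∈ stdSimplex ℝ Y,
    EReal.exp (-(((n * ((1 - α) / α) : ℝ) : EReal) *
      ((∑ x, (p x : EReal) * renyiDiv α (W x) q) - (r : EReal))))

end ChannelSim

end

/-!
Write `s = (1 - α) / α` and `φ_s(w, q) = s D_α(w‖q)`. The variational formula
`φ_s(w, q) = min_t (D(t‖w) + s D(t‖q))` is attained at the tilted distribution `t ∝ w^α q^{1-α}`;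
hence `φ_s` is concave in `s`, and it is convex in `q`. For an input word `xⁿ` one simulates
`W(·|xⁿ)` by the product `T` of tilted distributions, cut down to `T ⊓ e^{nr} qⁿ`. By Jensen's
inequality the fidelity with `W(·|xⁿ)` is at least
`exp (-(D(T‖W) + max 0 (D(T‖qⁿ) - nr)) - O(√n))`, where the error is the standard deviation of the
log-likelihood ratio `log (T/qⁿ)`, and the intermediate value theorem provides an `s ∈ [0, 1]` for
which the exponent is `∑ᵢ φ_s(W(·|xᵢ), q) - s n r`.

This sum depends on `xⁿ` only through its type `p`. Sion's minimax theorem, applied to distributions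
`q` bounded below by `η / (1 + η|Y|)`, gives one `q` for each `p` for which the exponent is at most
the one in `E_n(W, r)` for every `s`. Mixing the resulting product distributions over the at most
`(n+1)^{|X|}` types yields a single output distribution, at the cost of the factor `γ_n`.
-/

noncomputable section

namespace ChannelSim

section RelativeEntropy

variable {Y : Type*} [Fintype Y] {p q t : Y → ℝ}

/-- The relative entropy `D(p‖q)` as a real number. It is the relative entropy of the paper only
when the support of `p` is contained in that of `q`: elsewhere `p y / 0 = 0` and `log 0 = 0`. -/
def relEnt (p q : Y → ℝ) : ℝ := ∑ y, p y * Real.log (p y / q y)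

lemma relEnt_self (p : Y → ℝ) : relEnt p p = 0 :=
  Finset.sum_eq_zero fun y _ => by
    rcases eq_or_ne (p y) 0 with hy | hy <;> simp [hy]

lemma sub_le_mul_log_div {a b : ℝ} (ha : 0 ≤ a) (hb : 0 ≤ b) (hab : b = 0 → a = 0) :
    a - b ≤ a * Real.log (a / b) := by
  rcases hb.eq_or_lt with rfl | hb
  · simp [hab rfl]
  · have hkl := mul_nonneg hb.le (InformationTheory.klFun_nonneg (div_nonneg ha hb.le))
    have hexpand : b * InformationTheory.klFun (a / b) = a * Real.log (a / b) + b - a := by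
      rw [InformationTheory.klFun]
      field_simp
    linarith

lemma relEnt_nonneg (hp : p ∈ stdSimplex ℝ Y) (hq : q ∈ stdSimplex ℝ Y)
    (hpq : ∀ y, q y = 0 → p y = 0) : 0 ≤ relEnt p q :=
  calc 0 = ∑ y, (p y - q y) := by rw [Finset.sum_sub_distrib, hp.2, hq.2, sub_self]
    _ ≤ relEnt p q := Finset.sum_le_sum fun y _ =>
      sub_le_mul_log_div (hp.1 y) (hq.1 y) (hpq y)

lemma mul_log_div_sq_le {a b κ : ℝ} (ha₀ : 0 ≤ a) (ha₁ : a ≤ 1) (hκ : 0 < κ) (hb : κ ≤ b) :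
    a * Real.log (a / b) ^ 2 ≤ a * Real.log κ ^ 2 + 4 * b := by
  have hb₀ : 0 < b := hκ.trans_le hb
  rcases ha₀.eq_or_lt with rfl | ha₀
  · simpa using hb₀.le
  rcases le_total a b with hab | hab
  · have hz : 0 < a / b := div_pos ha₀ hb₀
    have hroot := Real.abs_log_mul_self_rpow_lt (a / b) (1 / 2) hz
      ((div_le_one hb₀).2 hab) (by norm_num)
    rw [← Real.sqrt_eq_rpow] at hroot
    have hsq : a / b * Real.log (a / b) ^ 2 ≤ 4 := by
      have := sq_le_sq' (by linarith [abs_nonneg (Real.log (a / b) * √(a / b))]) hroot.le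
      rw [sq_abs, mul_pow, Real.sq_sqrt hz.le] at this
      linarith
    have : a * Real.log (a / b) ^ 2 = b * (a / b * Real.log (a / b) ^ 2) := by field_simp
    nlinarith [mul_nonneg ha₀.le (sq_nonneg (Real.log κ))]
  · have hlog₀ : 0 ≤ Real.log (a / b) := Real.log_nonneg ((one_le_div hb₀).2 hab)
    have hlog₁ : Real.log (a / b) ≤ -Real.log κ := by
      rw [← Real.log_inv]
      refine Real.log_le_log (by positivity) ?_
      rw [← one_div]
      exact div_le_div₀ zero_le_one ha₁ hκ hb
    nlinarith [mul_le_mul_of_nonneg_left (pow_le_pow_left₀ hlog₀ hlog₁ 2) ha₀.le]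

lemma sum_mul_log_div_sq_le {κ : ℝ} (hp : p ∈ stdSimplex ℝ Y) (hq : q ∈ stdSimplex ℝ Y)
    (hκ : 0 < κ) (hκq : ∀ y, κ ≤ q y) :
    ∑ y, p y * Real.log (p y / q y) ^ 2 ≤ Real.log κ ^ 2 + 4 :=
  calc ∑ y, p y * Real.log (p y / q y) ^ 2
      ≤ ∑ y, (p y * Real.log κ ^ 2 + 4 * q y) := Finset.sum_le_sum fun y _ =>
        mul_log_div_sq_le (hp.1 y) (mem_Icc_of_mem_stdSimplex hp y).2 hκ (hκq y)
    _ = Real.log κ ^ 2 + 4 := by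
      rw [Finset.sum_add_distrib, ← Finset.sum_mul, ← Finset.mul_sum, hp.2, hq.2]
      ring

end RelativeEntropy

section Tilting

variable {Y : Type*} [Fintype Y] {w q t : Y → ℝ} {α s : ℝ}

/-- The Chernoff coefficient `∑ w^α q^(1-α) = exp ((α-1) D_α(w‖q))`. -/
def chernoffCoeff (α : ℝ) (w q : Y → ℝ) : ℝ := ∑ y, w y ^ α * q y ^ (1 - α)

/-- The tilted distribution between `w` and `q`: the distribution proportional to
`w^α q^(1-α)`. -/
def tiltedDist (α : ℝ) (w q : Y → ℝ) (y : Y) : ℝ :=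
  w y ^ α * q y ^ (1 - α) / chernoffCoeff α w q

/-- The exponent `((1-α)/α) D_α(w‖q)` in the parameter `s = (1-α)/α`, that is `α = (1+s)⁻¹`; in
this parametrization it is concave, and it equals `0` at `s = 0`. -/
def renyiExponent (s : ℝ) (w q : Y → ℝ) : ℝ :=
  -((1 + s) * Real.log (chernoffCoeff (1 + s)⁻¹ w q))

lemma chernoffCoeff_pos (hw : w ∈ stdSimplex ℝ Y) (hq : ∀ y, 0 < q y) :
    0 < chernoffCoeff α w q := by
  obtain ⟨y, -, hy⟩ : ∃ y ∈ Finset.univ, 0 < w y :=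
    Finset.exists_lt_of_sum_lt (by simp [hw.2])
  exact Finset.sum_pos' (fun z _ => mul_nonneg (Real.rpow_nonneg (hw.1 z) _)
      (Real.rpow_nonneg (hq z).le _))
    ⟨y, Finset.mem_univ y, mul_pos (Real.rpow_pos_of_pos hy _) (Real.rpow_pos_of_pos (hq y) _)⟩

lemma tiltedDist_mem_stdSimplex (hw : w ∈ stdSimplex ℝ Y) (hq : ∀ y, 0 < q y) :
    tiltedDist α w q ∈ stdSimplex ℝ Y := by
  refine ⟨fun y => div_nonneg (mul_nonneg (Real.rpow_nonneg (hw.1 y) _)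
    (Real.rpow_nonneg (hq y).le _)) (chernoffCoeff_pos hw hq).le, ?_⟩
  simp only [tiltedDist, ← Finset.sum_div]
  exact div_self (chernoffCoeff_pos hw hq).ne'

lemma tiltedDist_eq_zero_iff (hα : α ≠ 0) (hw : w ∈ stdSimplex ℝ Y) (hq : ∀ y, 0 < q y) {y : Y} :
    tiltedDist α w q y = 0 ↔ w y = 0 := by
  simp [tiltedDist, (chernoffCoeff_pos hw hq).ne', (Real.rpow_pos_of_pos (hq y) _).ne',
    Real.rpow_eq_zero (hw.1 y) hα]

lemma log_div_tiltedDist {a : ℝ} {y : Y} (ha : 0 < a) (hw : w ∈ stdSimplex ℝ Y)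
    (hq : ∀ y, 0 < q y) (hy : 0 < w y) :
    Real.log (a / tiltedDist α w q y) =
      α * Real.log (a / w y) + (1 - α) * Real.log (a / q y) +
        Real.log (chernoffCoeff α w q) := by
  have hwα := Real.rpow_pos_of_pos hy α
  have hqα := Real.rpow_pos_of_pos (hq y) (1 - α)
  have hZ := chernoffCoeff_pos (α := α) hw hq
  rw [tiltedDist, Real.log_div ha.ne' (by positivity), Real.log_div (by positivity) hZ.ne',
    Real.log_mul hwα.ne' hqα.ne', Real.log_rpow hy, Real.log_rpow (hq y),
    Real.log_div ha.ne' hy.ne', Real.log_div ha.ne' (hq y).ne']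
  ring

lemma relEnt_tiltedDist (hw : w ∈ stdSimplex ℝ Y) (hq : ∀ y, 0 < q y) (ht : t ∈ stdSimplex ℝ Y)
    (htw : ∀ y, w y = 0 → t y = 0) :
    relEnt t (tiltedDist α w q) =
      α * relEnt t w + (1 - α) * relEnt t q + Real.log (chernoffCoeff α w q) := by
  have hpointwise (y : Y) : t y * Real.log (t y / tiltedDist α w q y) =
      α * (t y * Real.log (t y / w y)) + (1 - α) * (t y * Real.log (t y / q y)) +
        t y * Real.log (chernoffCoeff α w q) := by
    rcases (ht.1 y).eq_or_lt with hy | hy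
    · simp [← hy]
    · rw [log_div_tiltedDist hy hw hq ((hw.1 y).lt_of_ne fun h => hy.ne' (htw y h.symm))]
      ring
  simp only [relEnt, hpointwise, Finset.sum_add_distrib, ← Finset.mul_sum, ← Finset.sum_mul,
    ht.2, one_mul]

lemma relEnt_add_mul_relEnt (hs : 1 + s ≠ 0) (hw : w ∈ stdSimplex ℝ Y) (hq : ∀ y, 0 < q y)
    (ht : t ∈ stdSimplex ℝ Y) (htw : ∀ y, w y = 0 → t y = 0) :
    relEnt t w + s * relEnt t q =
      renyiExponent s w q + (1 + s) * relEnt t (tiltedDist (1 + s)⁻¹ w q) := by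
  rw [relEnt_tiltedDist hw hq ht htw, renyiExponent]
  field_simp
  ring

lemma relEnt_tiltedDist_add_mul_relEnt (hs : 1 + s ≠ 0) (hw : w ∈ stdSimplex ℝ Y)
    (hq : ∀ y, 0 < q y) :
    relEnt (tiltedDist (1 + s)⁻¹ w q) w + s * relEnt (tiltedDist (1 + s)⁻¹ w q) q =
      renyiExponent s w q := by
  rw [relEnt_add_mul_relEnt hs hw hq (tiltedDist_mem_stdSimplex hw hq) fun y =>
    (tiltedDist_eq_zero_iff (inv_ne_zero hs) hw hq).2, relEnt_self, mul_zero, add_zero]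

lemma renyiExponent_le_relEnt (hs : 0 < 1 + s) (hw : w ∈ stdSimplex ℝ Y) (hq : ∀ y, 0 < q y)
    (ht : t ∈ stdSimplex ℝ Y) (htw : ∀ y, w y = 0 → t y = 0) :
    renyiExponent s w q ≤ relEnt t w + s * relEnt t q := by
  have hnonneg := relEnt_nonneg (q := tiltedDist (1 + s)⁻¹ w q) ht
    (tiltedDist_mem_stdSimplex hw hq) fun y hy =>
      htw y ((tiltedDist_eq_zero_iff (inv_ne_zero hs.ne') hw hq).1 hy)
  rw [relEnt_add_mul_relEnt hs.ne' hw hq ht htw]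
  exact le_add_of_nonneg_right (mul_nonneg hs.le hnonneg)

lemma renyiExponent_zero (hw : w ∈ stdSimplex ℝ Y) : renyiExponent 0 w q = 0 := by
  simp [renyiExponent, chernoffCoeff, hw.2]

/-- By the variational formula the exponent is a minimum of affine functions of `s`. -/
lemma concaveOn_renyiExponent (hw : w ∈ stdSimplex ℝ Y) (hq : ∀ y, 0 < q y) :
    ConcaveOn ℝ (Set.Ioi (-1)) fun s => renyiExponent s w q := by
  refine ⟨convex_Ioi (-1), fun s hs s' hs' a b ha hb hab => ?_⟩
  set m := a • s + b • s'
  have hpos {z : ℝ} (hz : z ∈ Set.Ioi (-1)) : 0 < 1 + z := neg_lt_iff_pos_add'.1 hz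
  have hm : 0 < 1 + m := hpos (convex_Ioi (-1 : ℝ) hs hs' ha hb hab)
  set t := tiltedDist (1 + m)⁻¹ w q
  have ht : t ∈ stdSimplex ℝ Y := tiltedDist_mem_stdSimplex hw hq
  have htw (y : Y) (hy : w y = 0) : t y = 0 :=
    (tiltedDist_eq_zero_iff (inv_ne_zero hm.ne') hw hq).2 hy
  calc a * renyiExponent s w q + b * renyiExponent s' w q
      ≤ a * (relEnt t w + s * relEnt t q) + b * (relEnt t w + s' * relEnt t q) := by
        gcongr
        · exact renyiExponent_le_relEnt (hpos hs) hw hq ht htw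
        · exact renyiExponent_le_relEnt (hpos hs') hw hq ht htw
    _ = (a + b) * relEnt t w + m * relEnt t q := by simp only [m, smul_eq_mul]; ring
    _ = renyiExponent m w q := by
      rw [hab, one_mul, relEnt_tiltedDist_add_mul_relEnt hm.ne' hw hq]

lemma concaveOn_chernoffCoeff (hα₀ : 0 ≤ α) (hα₁ : α ≤ 1) (hw : ∀ y, 0 ≤ w y) :
    ConcaveOn ℝ (Set.Ici 0) fun q => chernoffCoeff α w q := by
  refine ⟨convex_Ici 0, fun q hq q' hq' a b ha hb hab => ?_⟩
  simp only [chernoffCoeff, smul_eq_mul, Finset.mul_sum, ← Finset.sum_add_distrib]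
  refine Finset.sum_le_sum fun y _ => ?_
  have hroot := (Real.concaveOn_rpow (sub_nonneg.2 hα₁) (sub_le_self 1 hα₀)).2
    (hq y) (hq' y) ha hb hab
  have := mul_le_mul_of_nonneg_left hroot (Real.rpow_nonneg (hw y) α)
  simp only [smul_eq_mul, Pi.add_apply, Pi.smul_apply] at this ⊢
  linarith

lemma convexOn_renyiExponent (hs : 0 ≤ s) (hw : w ∈ stdSimplex ℝ Y) :
    ConvexOn ℝ {q : Y → ℝ | ∀ y, 0 < q y} (renyiExponent s w) := by
  have hconvex : Convex ℝ {q : Y → ℝ | ∀ y, 0 < q y} := fun q hq q' hq' a b ha hb hab y =>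
    convex_Ioi (0 : ℝ) (hq y) (hq' y) ha hb hab
  have hcoeff := (concaveOn_chernoffCoeff (α := (1 + s)⁻¹) (by positivity)
    (inv_le_one_of_one_le₀ (by linarith)) hw.1).subset (fun q hq y => (hq y).le) hconvex
  refine ⟨hconvex, fun q hq q' hq' a b ha hb hab => ?_⟩
  have hlog : a • Real.log (chernoffCoeff (1 + s)⁻¹ w q) +
      b • Real.log (chernoffCoeff (1 + s)⁻¹ w q') ≤
        Real.log (chernoffCoeff (1 + s)⁻¹ w (a • q + b • q')) :=
    (strictConcaveOn_log_Ioi.concaveOn.2 (chernoffCoeff_pos hw hq) (chernoffCoeff_pos hw hq')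
      ha hb hab).trans (Real.log_le_log (convex_Ioi (0 : ℝ) (chernoffCoeff_pos hw hq)
        (chernoffCoeff_pos hw hq') ha hb hab) (hcoeff.2 hq hq' ha hb hab))
  have := mul_le_mul_of_nonneg_left hlog (by linarith : 0 ≤ 1 + s)
  simp only [renyiExponent, smul_eq_mul] at this ⊢
  linarith

lemma continuousOn_rpow_mul_rpow (a : ℝ) {b : ℝ} (hb : b ≠ 0) :
    ContinuousOn (fun α : ℝ => a ^ α * b ^ (1 - α)) (Set.Ioi 0) := by
  refine ContinuousOn.mul (fun α hα => ?_) (Continuous.continuousOn ?_)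
  · exact (Real.continuousAt_const_rpow' (Set.mem_Ioi.1 hα).ne').continuousWithinAt
  · exact (Real.continuous_const_rpow hb).comp (continuous_const.sub continuous_id)

lemma continuousOn_chernoffCoeff (hq : ∀ y, 0 < q y) :
    ContinuousOn (fun α => chernoffCoeff α w q) (Set.Ioi 0) :=
  continuousOn_finsetSum _ fun y _ => continuousOn_rpow_mul_rpow (w y) (hq y).ne'

lemma continuousOn_relEnt_tiltedDist (hw : w ∈ stdSimplex ℝ Y) (hq : ∀ y, 0 < q y) :
    ContinuousOn (fun α => relEnt (tiltedDist α w q) q) (Set.Ioi 0) := by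
  refine continuousOn_finsetSum _ fun y _ => ?_
  have htilted : ContinuousOn (fun α => tiltedDist α w q y) (Set.Ioi 0) :=
    (continuousOn_rpow_mul_rpow (w y) (hq y).ne').div (continuousOn_chernoffCoeff hq)
      fun _ _ => (chernoffCoeff_pos hw hq).ne'
  have hkey : Continuous fun z : ℝ => q y * (z / q y * Real.log (z / q y)) :=
    continuous_const.mul (Real.continuous_mul_log.comp (continuous_id.div_const _))
  refine (hkey.comp_continuousOn htilted).congr fun α _ => ?_
  have := (hq y).ne'
  simp only [Function.comp_apply]
  field_simp

lemma continuousOn_inv_one_add : ContinuousOn (fun s : ℝ => (1 + s)⁻¹) (Set.Ioi (-1)) :=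
  (continuousOn_const.add continuousOn_id).inv₀ fun _ hs =>
    (neg_lt_iff_pos_add'.1 hs).ne'

lemma mapsTo_inv_one_add : Set.MapsTo (fun s : ℝ => (1 + s)⁻¹) (Set.Ioi (-1)) (Set.Ioi 0) :=
  fun _ hs => Set.mem_Ioi.2 (inv_pos.2 (neg_lt_iff_pos_add'.1 hs))

lemma continuousOn_renyiExponent_left (hw : w ∈ stdSimplex ℝ Y) (hq : ∀ y, 0 < q y) :
    ContinuousOn (fun s => renyiExponent s w q) (Set.Ioi (-1)) :=
  ((continuousOn_const.add continuousOn_id).mul (((continuousOn_chernoffCoeff hq).comp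
    continuousOn_inv_one_add mapsTo_inv_one_add).log fun _ _ =>
      (chernoffCoeff_pos hw hq).ne')).neg

lemma continuousOn_renyiExponent_right (hw : w ∈ stdSimplex ℝ Y) :
    ContinuousOn (renyiExponent s w) {q : Y → ℝ | ∀ y, 0 < q y} := by
  refine (continuousOn_const.mul (ContinuousOn.log ?_ fun q hq =>
    (chernoffCoeff_pos hw hq).ne')).neg
  exact continuousOn_finsetSum _ fun y _ => continuousOn_const.mul
    ((continuous_apply y).continuousOn.rpow_const fun q hq => Or.inl (hq y).ne')

end Tilting

section ProductDistributions

variable {ι Y : Type*} [Fintype ι] {t w g : ι → Y → ℝ}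

/-- The product distribution `⨂ᵢ tᵢ` on `ι → Y`. The rows of `tensorPower W n` are of this form. -/
def prodDist (t : ι → Y → ℝ) (y : ι → Y) : ℝ := ∏ i, t i (y i)

lemma prodDist_pos_iff (ht : ∀ i y, 0 ≤ t i y) {y : ι → Y} :
    0 < prodDist t y ↔ ∀ i, 0 < t i (y i) := by
  refine ⟨fun hy i => (ht i _).lt_of_ne fun hi => hy.ne' ?_, fun hy =>
    Finset.prod_pos fun i _ => hy i⟩
  exact Finset.prod_eq_zero (Finset.mem_univ i) hi.symm

lemma prodDist_mul_log_div (ht : ∀ i y, 0 ≤ t i y) (htw : ∀ i y, 0 < t i y → 0 < w i y)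
    (y : ι → Y) :
    prodDist t y * Real.log (prodDist t y / prodDist w y) =
      prodDist t y * ∑ i, Real.log (t i (y i) / w i (y i)) := by
  have hprod : 0 ≤ prodDist t y := Finset.prod_nonneg fun i _ => ht i (y i)
  rcases hprod.eq_or_lt with hy | hy
  · rw [← hy, zero_mul, zero_mul]
  · have hpos := (prodDist_pos_iff ht).1 hy
    rw [prodDist, prodDist, ← Finset.prod_div_distrib, Real.log_prod fun i _ =>
      (div_pos (hpos i) (htw i _ (hpos i))).ne']

variable [DecidableEq ι] [Fintype Y]

lemma sum_prodDist_mul_prod (t g : ι → Y → ℝ) :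
    ∑ y, prodDist t y * ∏ i, g i (y i) = ∏ i, ∑ y, t i y * g i y := by
  simp only [prodDist, ← Finset.prod_mul_distrib, Fintype.prod_sum]

lemma prodDist_mem_stdSimplex (ht : ∀ i, t i ∈ stdSimplex ℝ Y) :
    prodDist t ∈ stdSimplex ℝ (ι → Y) := by
  refine ⟨fun y => Finset.prod_nonneg fun i _ => (ht i).1 _, ?_⟩
  simpa [(ht _).2] using sum_prodDist_mul_prod t fun _ _ => 1

lemma sum_prodDist_mul_apply (ht : ∀ i, t i ∈ stdSimplex ℝ Y) (i : ι) (f : Y → ℝ) :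
    ∑ y, prodDist t y * f (y i) = ∑ z, t i z * f z := by
  have hprod := sum_prodDist_mul_prod t fun j z => if j = i then f z else 1
  have hmarginal (j : ι) : ∑ z, t j z * (if j = i then f z else 1) =
      if j = i then ∑ z, t i z * f z else 1 := by
    split_ifs with hj
    · rw [hj]
    · simp [(ht j).2]
  simpa only [hmarginal, Finset.prod_ite_eq', Finset.mem_univ, if_true] using hprod

lemma sum_prodDist_mul_sum (ht : ∀ i, t i ∈ stdSimplex ℝ Y) (g : ι → Y → ℝ) :
    ∑ y, prodDist t y * ∑ i, g i (y i) = ∑ i, ∑ z, t i z * g i z := by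
  simp only [Finset.mul_sum]
  rw [Finset.sum_comm]
  exact Finset.sum_congr rfl fun i _ => sum_prodDist_mul_apply ht i (g i)

lemma sum_prodDist_mul_mul_eq_zero {i k : ι} (hik : i ≠ k) (hg : ∑ z, t i z * g i z = 0) :
    ∑ y, prodDist t y * (g i (y i) * g k (y k)) = 0 := by
  have hprod := sum_prodDist_mul_prod t fun j z =>
    (if j = i then g i z else 1) * if j = k then g k z else 1
  simp only [Finset.prod_mul_distrib, Finset.prod_ite_eq', Finset.mem_univ, if_true] at hprod
  rw [hprod]
  exact Finset.prod_eq_zero (Finset.mem_univ i) (by simpa [hik] using hg)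

lemma sum_prodDist_mul_sum_sq (ht : ∀ i, t i ∈ stdSimplex ℝ Y)
    (hg : ∀ i, ∑ z, t i z * g i z = 0) :
    ∑ y, prodDist t y * (∑ i, g i (y i)) ^ 2 = ∑ i, ∑ z, t i z * g i z ^ 2 := by
  calc ∑ y, prodDist t y * (∑ i, g i (y i)) ^ 2
      = ∑ i, ∑ k, ∑ y, prodDist t y * (g i (y i) * g k (y k)) := by
        simp only [sq, Finset.sum_mul_sum]
        simp only [Finset.mul_sum]
        rw [Finset.sum_comm]
        exact Finset.sum_congr rfl fun i _ => Finset.sum_comm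
    _ = ∑ i, ∑ y, prodDist t y * g i (y i) ^ 2 := by
        refine Finset.sum_congr rfl fun i _ => ?_
        rw [Finset.sum_eq_single i (fun k _ hki => sum_prodDist_mul_mul_eq_zero hki.symm (hg i))
          fun hi => absurd (Finset.mem_univ i) hi]
        simp only [sq]
    _ = ∑ i, ∑ z, t i z * g i z ^ 2 :=
        Finset.sum_congr rfl fun i _ => sum_prodDist_mul_apply ht i fun z => g i z ^ 2

lemma sum_mul_sub_sum_sq_le {p : Y → ℝ} (hp : p ∈ stdSimplex ℝ Y) (f : Y → ℝ) :
    ∑ z, p z * (f z - ∑ z', p z' * f z') ^ 2 ≤ ∑ z, p z * f z ^ 2 := by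
  set m := ∑ z', p z' * f z' with hm
  have hexpand : ∑ z, p z * (f z - m) ^ 2 = ∑ z, p z * f z ^ 2 - m ^ 2 := by
    calc ∑ z, p z * (f z - m) ^ 2
        = ∑ z, (p z * f z ^ 2 - 2 * m * (p z * f z) + p z * m ^ 2) :=
          Finset.sum_congr rfl fun z _ => by ring
      _ = ∑ z, p z * f z ^ 2 - m ^ 2 := by
          rw [Finset.sum_add_distrib, Finset.sum_sub_distrib, ← Finset.mul_sum, ← Finset.sum_mul,
            hp.2, ← hm]
          ring
  rw [hexpand]
  exact sub_le_self _ (sq_nonneg m)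

lemma sum_prodDist_mul_abs_sub_le (ht : ∀ i, t i ∈ stdSimplex ℝ Y) (g : ι → Y → ℝ) :
    ∑ y, prodDist t y * |∑ i, g i (y i) - ∑ i, ∑ z, t i z * g i z| ≤
      √(∑ i, ∑ z, t i z * g i z ^ 2) := by
  set m : ι → ℝ := fun i => ∑ z, t i z * g i z
  have hcentred (i : ι) : ∑ z, t i z * (g i z - m i) = 0 := by
    simp only [mul_sub, Finset.sum_sub_distrib, ← Finset.sum_mul, (ht i).2, one_mul, m, sub_self]
  have hT := prodDist_mem_stdSimplex ht
  have hjensen := Real.pow_arith_mean_le_arith_mean_pow Finset.univ (prodDist t)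
    (fun y => |∑ i, (g i (y i) - m i)|) (fun y _ => hT.1 y) hT.2 (fun y _ => abs_nonneg _) 2
  simp only [sq_abs, sum_prodDist_mul_sum_sq ht (g := fun i z => g i z - m i) hcentred] at hjensen
  simp only [← Finset.sum_sub_distrib]
  exact Real.le_sqrt_of_sq_le (hjensen.trans (Finset.sum_le_sum fun i _ =>
    sum_mul_sub_sum_sq_le (ht i) (g i)))

lemma relEnt_prodDist (ht : ∀ i, t i ∈ stdSimplex ℝ Y) (htw : ∀ i y, 0 < t i y → 0 < w i y) :
    relEnt (prodDist t) (prodDist w) = ∑ i, relEnt (t i) (w i) := by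
  simp only [relEnt, prodDist_mul_log_div (fun i => (ht i).1) htw]
  exact sum_prodDist_mul_sum ht fun i z => Real.log (t i z / w i z)

end ProductDistributions

section Fidelity

variable {Y : Type*} [Fintype Y] {p t u v : Y → ℝ}

lemma fidelity_mono_right (huv : ∀ y, u y ≤ v y) : fidelity p u ≤ fidelity p v := by
  unfold fidelity
  gcongr with y
  exact huv y

lemma fidelity_smul_right {c : ℝ} (hc : 0 ≤ c) (p u : Y → ℝ) :
    fidelity p (c • u) = c * fidelity p u := by
  have hroot (y : Y) : √(p y) * √((c • u) y) = √c * (√(p y) * √(u y)) := by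
    rw [Pi.smul_apply, smul_eq_mul, Real.sqrt_mul hc]
    ring
  simp only [fidelity, hroot, ← Finset.mul_sum, mul_pow, Real.sq_sqrt hc]

lemma fidelity_le_one (hp : p ∈ stdSimplex ℝ Y) (hu : u ∈ stdSimplex ℝ Y) : fidelity p u ≤ 1 := by
  have hsum := Real.sum_sqrt_mul_sqrt_le Finset.univ hp.1 hu.1
  rw [hp.2, hu.2, Real.sqrt_one, one_mul] at hsum
  exact pow_le_one₀ (by positivity) hsum

lemma sqrt_mul_sqrt_eq_mul_exp {a b c : ℝ} (ha : 0 < a) (hb : 0 < b) (hc : 0 < c) :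
    √b * √c = a * Real.exp (-((Real.log (a / b) + Real.log (a / c)) / 2)) := by
  rw [← Real.log_mul (by positivity) (by positivity), ← neg_div, ← Real.log_inv, Real.exp_half,
    Real.exp_log (by positivity)]
  calc √b * √c = √(a ^ 2 * (a / b * (a / c))⁻¹) := by
        rw [← Real.sqrt_mul hb.le]
        congr 1
        field_simp
    _ = a * √(a / b * (a / c))⁻¹ := by rw [Real.sqrt_mul (sq_nonneg a), Real.sqrt_sq ha.le]

/-- Jensen's inequality under `t`, since `√p √u = t exp (-(log (t / p) + log (t / u)) / 2)` on the
support of `t`. -/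
lemma exp_neg_relEnt_add_le_fidelity (ht : t ∈ stdSimplex ℝ Y) (htp : ∀ y, 0 < t y → 0 < p y)
    (htu : ∀ y, 0 < t y → 0 < u y) :
    Real.exp (-(relEnt t p + relEnt t u)) ≤ fidelity p u := by
  set ℓ : Y → ℝ := fun y => -((Real.log (t y / p y) + Real.log (t y / u y)) / 2)
  have hjensen : Real.exp (∑ y, t y * ℓ y) ≤ ∑ y, t y * Real.exp (ℓ y) :=
    convexOn_exp.map_sum_le (fun y _ => ht.1 y) ht.2 fun y _ => Set.mem_univ _
  have hroot (y : Y) : t y * Real.exp (ℓ y) ≤ √(p y) * √(u y) := by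
    rcases (ht.1 y).eq_or_lt with hy | hy
    · rw [← hy, zero_mul]
      positivity
    · exact (sqrt_mul_sqrt_eq_mul_exp hy (htp y hy) (htu y hy)).ge
  have hexponent : ∑ y, t y * ℓ y = -((relEnt t p + relEnt t u) / 2) := by
    simp only [relEnt, ℓ, ← Finset.sum_add_distrib, Finset.sum_div, ← Finset.sum_neg_distrib]
    exact Finset.sum_congr rfl fun y _ => by ring
  calc Real.exp (-(relEnt t p + relEnt t u))
      = Real.exp (-((relEnt t p + relEnt t u) / 2)) ^ 2 := by
        rw [← Real.exp_nat_mul]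
        congr 1
        push_cast
        ring
    _ ≤ fidelity p u := by
        rw [← hexponent]
        exact pow_le_pow_left₀ (Real.exp_nonneg _)
          (hjensen.trans (Finset.sum_le_sum fun y _ => hroot y)) 2

lemma relEnt_inf_right (ht : ∀ y, 0 ≤ t y) (htu : ∀ y, 0 < t y → 0 < u y) :
    relEnt t (t ⊓ u) = ∑ y, t y * max 0 (Real.log (t y / u y)) := by
  refine Finset.sum_congr rfl fun y _ => ?_
  rcases (ht y).eq_or_lt with hy | hy
  · simp [← hy]
  · have huy := htu y hy
    rcases le_total (t y) (u y) with hle | hle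
    · rw [Pi.inf_apply, inf_eq_left.2 hle, div_self hy.ne', Real.log_one,
        max_eq_left (Real.log_nonpos (by positivity) ((div_le_one huy).2 hle))]
    · rw [Pi.inf_apply, inf_eq_right.2 hle,
        max_eq_right (Real.log_nonneg ((one_le_div huy).2 hle))]

lemma sum_mul_max_zero_le (ht : t ∈ stdSimplex ℝ Y) (f : Y → ℝ) (m : ℝ) :
    ∑ y, t y * max 0 (f y) ≤ max 0 m + ∑ y, t y * |f y - m| :=
  calc ∑ y, t y * max 0 (f y)
      ≤ ∑ y, (t y * max 0 m + t y * |f y - m|) := by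
        refine Finset.sum_le_sum fun y _ => ?_
        rw [← mul_add]
        refine mul_le_mul_of_nonneg_left (max_le (by positivity) ?_) (ht.1 y)
        linarith [le_abs_self (f y - m), le_max_right 0 m]
    _ = max 0 m + ∑ y, t y * |f y - m| := by
        rw [Finset.sum_add_distrib, ← Finset.sum_mul, ht.2, one_mul]

end Fidelity

section TiltedProducts

variable {ι Y : Type*} [Fintype ι] [DecidableEq ι] [Fintype Y] {t w q : ι → Y → ℝ}

lemma relEnt_prodDist_inf_smul_le (ht : ∀ i, t i ∈ stdSimplex ℝ Y) (hq : ∀ i y, 0 < q i y)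
    (R : ℝ) :
    relEnt (prodDist t) (prodDist t ⊓ Real.exp R • prodDist q) ≤
      max 0 (∑ i, relEnt (t i) (q i) - R) +
        √(∑ i, ∑ y, t i y * Real.log (t i y / q i y) ^ 2) := by
  have hT := prodDist_mem_stdSimplex ht
  have hQ (y : ι → Y) : 0 < prodDist q y := Finset.prod_pos fun i _ => hq i (y i)
  have hlog (y : ι → Y) :
      prodDist t y * max 0 (Real.log (prodDist t y / (Real.exp R • prodDist q) y)) =
        prodDist t y * max 0 (∑ i, Real.log (t i (y i) / q i (y i)) - R) := by
    rcases (hT.1 y).eq_or_lt with hy | hy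
    · rw [← hy, zero_mul, zero_mul]
    · have := mul_left_cancel₀ hy.ne'
        (prodDist_mul_log_div (fun i => (ht i).1) (fun i y _ => hq i y) y)
      rw [Pi.smul_apply, smul_eq_mul, mul_comm (Real.exp R), ← div_div,
        Real.log_div (div_pos hy (hQ y)).ne' (Real.exp_ne_zero R), Real.log_exp, this]
  rw [relEnt_inf_right hT.1 fun y _ => by simpa using mul_pos (Real.exp_pos R) (hQ y)]
  calc ∑ y, prodDist t y * max 0 (Real.log (prodDist t y / (Real.exp R • prodDist q) y))
      = ∑ y, prodDist t y * max 0 (∑ i, Real.log (t i (y i) / q i (y i)) - R) :=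
        Finset.sum_congr rfl fun y _ => hlog y
    _ ≤ _ := sum_mul_max_zero_le hT _ (∑ i, relEnt (t i) (q i) - R)
    _ ≤ _ := by
        simp only [sub_sub_sub_cancel_right]
        exact add_le_add_right (sum_prodDist_mul_abs_sub_le ht fun i y =>
          Real.log (t i y / q i y)) _

lemma exp_neg_le_fidelity_prodDist (ht : ∀ i, t i ∈ stdSimplex ℝ Y)
    (htw : ∀ i y, 0 < t i y → 0 < w i y) (hq : ∀ i y, 0 < q i y) (R : ℝ) :
    Real.exp (-(∑ i, relEnt (t i) (w i) + (max 0 (∑ i, relEnt (t i) (q i) - R) +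
        √(∑ i, ∑ y, t i y * Real.log (t i y / q i y) ^ 2)))) ≤
      fidelity (prodDist w) (prodDist t ⊓ Real.exp R • prodDist q) := by
  have hT := prodDist_mem_stdSimplex ht
  have hQ (y : ι → Y) : 0 < prodDist q y := Finset.prod_pos fun i _ => hq i (y i)
  refine le_trans ?_ (exp_neg_relEnt_add_le_fidelity hT (fun y hy => ?_) fun y hy => ?_)
  · rw [Real.exp_le_exp, neg_le_neg_iff, relEnt_prodDist ht htw]
    exact add_le_add_right (relEnt_prodDist_inf_smul_le ht hq R) _
  · exact Finset.prod_pos fun i _ =>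
      htw i _ ((prodDist_pos_iff fun i => (ht i).1).1 hy i)
  · exact lt_inf_iff.2 ⟨hy, mul_pos (Real.exp_pos R) (hQ y)⟩

lemma exists_max_zero_eq_mul {g : ℝ → ℝ} (hg : ContinuousOn g (Set.Icc 0 1)) :
    ∃ s ∈ Set.Icc (0 : ℝ) 1, max 0 (g s) = s * g s := by
  rcases le_or_gt (g 0) 0 with hg₀ | hg₀
  · exact ⟨0, ⟨le_rfl, zero_le_one⟩, by rw [max_eq_left hg₀, zero_mul]⟩
  rcases le_or_gt 0 (g 1) with hg₁ | hg₁
  · exact ⟨1, ⟨zero_le_one, le_rfl⟩, by rw [max_eq_right hg₁, one_mul]⟩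
  · obtain ⟨s, hs, hgs⟩ := intermediate_value_Icc' zero_le_one hg ⟨hg₁.le, hg₀.le⟩
    exact ⟨s, hs, by rw [hgs, max_self, mul_zero]⟩

/-- The parameter `s` is chosen so that the tilted distributions satisfy
`max 0 (D - R) = s (D - R)` for their total divergence `D` from `q`. -/
lemma exists_exp_neg_renyiExponent_le_fidelity {q : Y → ℝ} {κ : ℝ}
    (hw : ∀ i, w i ∈ stdSimplex ℝ Y) (hκ : 0 < κ) (hq : q ∈ stdSimplex ℝ Y)
    (hκq : ∀ y, κ ≤ q y) (R : ℝ) :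
    ∃ s ∈ Set.Icc (0 : ℝ) 1, ∃ t ∈ stdSimplex ℝ (ι → Y),
      Real.exp (-(∑ i, renyiExponent s (w i) q - s * R +
          √(Fintype.card ι * (Real.log κ ^ 2 + 4)))) ≤
        fidelity (prodDist w) (t ⊓ Real.exp R • prodDist fun _ => q) := by
  have hqpos (y : Y) : 0 < q y := hκ.trans_le (hκq y)
  have hIcc : Set.Icc (0 : ℝ) 1 ⊆ Set.Ioi (-1) := fun s hs =>
    Set.mem_Ioi.2 (neg_one_lt_zero.trans_le hs.1)
  have hcont : ContinuousOn (fun s : ℝ => ∑ i, relEnt (tiltedDist (1 + s)⁻¹ (w i) q) q - R)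
      (Set.Icc 0 1) :=
    ((continuousOn_finsetSum _ fun i _ => (continuousOn_relEnt_tiltedDist (hw i) hqpos).comp
      continuousOn_inv_one_add mapsTo_inv_one_add).mono hIcc).sub continuousOn_const
  obtain ⟨s, hs, hmax⟩ := exists_max_zero_eq_mul hcont
  have hs' : 1 + s ≠ 0 := (add_pos_of_pos_of_nonneg one_pos hs.1).ne'
  set t : ι → Y → ℝ := fun i => tiltedDist (1 + s)⁻¹ (w i) q
  have ht (i : ι) : t i ∈ stdSimplex ℝ Y := tiltedDist_mem_stdSimplex (hw i) hqpos
  have htw (i : ι) (y : Y) (hy : 0 < t i y) : 0 < w i y := ((hw i).1 y).lt_of_ne fun h =>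
    hy.ne' ((tiltedDist_eq_zero_iff (inv_ne_zero hs') (hw i) hqpos).2 h.symm)
  refine ⟨s, hs, prodDist t, prodDist_mem_stdSimplex ht, le_trans ?_
    (exp_neg_le_fidelity_prodDist ht htw (fun _ => hqpos) R)⟩
  have hexponent : ∑ i, relEnt (t i) (w i) + s * ∑ i, relEnt (t i) q =
      ∑ i, renyiExponent s (w i) q := by
    rw [Finset.mul_sum, ← Finset.sum_add_distrib]
    exact Finset.sum_congr rfl fun i _ => relEnt_tiltedDist_add_mul_relEnt hs' (hw i) hqpos
  have hmoment : ∑ i, ∑ y, t i y * Real.log (t i y / q y) ^ 2 ≤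
      Fintype.card ι * (Real.log κ ^ 2 + 4) :=
    (Finset.sum_le_card_nsmul _ _ _ fun i _ => sum_mul_log_div_sq_le (ht i) hq hκ hκq).trans_eq
      (by rw [Finset.card_univ, nsmul_eq_mul])
  rw [Real.exp_le_exp, hmax]
  linarith [Real.sqrt_le_sqrt hmoment]

end TiltedProducts

section MeanExponent

variable {X Y : Type*} [Fintype X] [Fintype Y] {W : X → Y → ℝ} {p : X → ℝ} {q : Y → ℝ} {s : ℝ}

/-- The exponent `((1-α)/α) E_{x∼p} D_α(W(·|x)‖q)` in the parameter `s = (1-α)/α`. -/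
def meanExponent (W : X → Y → ℝ) (p : X → ℝ) (s : ℝ) (q : Y → ℝ) : ℝ :=
  ∑ x, p x * renyiExponent s (W x) q

lemma convexOn_sum_mul {E : Type*} [AddCommMonoid E] [Module ℝ E] {S : Set E} {f : X → E → ℝ}
    (hS : Convex ℝ S) (hp : ∀ x, 0 ≤ p x) (hf : ∀ x, ConvexOn ℝ S (f x)) :
    ConvexOn ℝ S fun z => ∑ x, p x * f x z := by
  refine ⟨hS, fun z hz z' hz' a b ha hb hab => ?_⟩
  simp only [smul_eq_mul, Finset.mul_sum, ← Finset.sum_add_distrib]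
  refine Finset.sum_le_sum fun x _ => ?_
  have := mul_le_mul_of_nonneg_left ((hf x).2 hz hz' ha hb hab) (hp x)
  simp only [smul_eq_mul] at this
  linarith

lemma convexOn_meanExponent (hs : 0 ≤ s) (hW : IsChannel W) (hp : ∀ x, 0 ≤ p x) :
    ConvexOn ℝ {q : Y → ℝ | ∀ y, 0 < q y} (meanExponent W p s) :=
  convexOn_sum_mul (fun _ hq _ hq' _ _ ha hb hab y => convex_Ioi (0 : ℝ) (hq y) (hq' y) ha hb hab)
    hp fun x => convexOn_renyiExponent hs (hW x)

lemma concaveOn_meanExponent (hW : IsChannel W) (hp : ∀ x, 0 ≤ p x) (hq : ∀ y, 0 < q y) :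
    ConcaveOn ℝ (Set.Ioi (-1)) fun s => meanExponent W p s q := by
  refine neg_convexOn_iff.1 ((convexOn_sum_mul (convex_Ioi (-1)) hp fun x =>
    (concaveOn_renyiExponent (hW x) hq).neg).congr fun s _ => ?_)
  simp [meanExponent]

lemma continuousOn_meanExponent_left (hW : IsChannel W) (hq : ∀ y, 0 < q y) :
    ContinuousOn (fun s => meanExponent W p s q) (Set.Ioi (-1)) :=
  continuousOn_finsetSum _ fun x _ =>
    continuousOn_const.mul (continuousOn_renyiExponent_left (hW x) hq)

lemma continuousOn_meanExponent_right (hW : IsChannel W) :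
    ContinuousOn (meanExponent W p s) {q : Y → ℝ | ∀ y, 0 < q y} :=
  continuousOn_finsetSum _ fun x _ =>
    continuousOn_const.mul (continuousOn_renyiExponent_right (hW x))

lemma exists_isSaddlePointOn_meanExponent {K : Set (Y → ℝ)} (hW : IsChannel W)
    (hp : ∀ x, 0 ≤ p x) (hK : Convex ℝ K) (hKc : IsCompact K) (hKne : K.Nonempty)
    (hKpos : K ⊆ {q | ∀ y, 0 < q y}) (r : ℝ) :
    ∃ q ∈ K, ∃ s ∈ Set.Icc (0 : ℝ) 1,
      IsSaddlePointOn K (Set.Icc 0 1) (fun q s => meanExponent W p s q - s * r) q s := by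
  have hIcc : Set.Icc (0 : ℝ) 1 ⊆ Set.Ioi (-1) := fun s hs =>
    Set.mem_Ioi.2 (neg_one_lt_zero.trans_le hs.1)
  refine Sion.exists_isSaddlePointOn hKne hK hKc (fun s _ => ?_) (fun s hs => ?_) (convex_Icc 0 1)
    (Set.nonempty_Icc.2 zero_le_one) isCompact_Icc (fun q hq => ?_) fun q hq => ?_
  · exact (((continuousOn_meanExponent_right hW).mono hKpos).sub
      continuousOn_const).lowerSemicontinuousOn
  · exact (((convexOn_meanExponent hs.1 hW hp).subset hKpos hK).add_const _).quasiconvexOn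
  · exact (((continuousOn_meanExponent_left hW (hKpos hq)).mono hIcc).sub
      (continuousOn_id.mul continuousOn_const)).upperSemicontinuousOn
  · refine (((concaveOn_meanExponent hW hp (hKpos hq)).subset hIcc (convex_Icc 0 1)).sub
      ⟨convex_Icc 0 1, fun s _ s' _ a b _ _ _ => ?_⟩).quasiconcaveOn
    simp only [smul_eq_mul]
    linarith

end MeanExponent

section RenyiDivergence

variable {X Y : Type*} [Fintype Y] {w q q' : Y → ℝ} {α s c : ℝ}

lemma chernoffCoeff_le_of_le_mul (hα : α ≤ 1) (hc : 0 ≤ c) (hw : ∀ y, 0 ≤ w y)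
    (hq : ∀ y, 0 ≤ q y) (hq' : ∀ y, 0 ≤ q' y) (hqq' : ∀ y, q y ≤ c * q' y) :
    chernoffCoeff α w q ≤ c ^ (1 - α) * chernoffCoeff α w q' := by
  rw [chernoffCoeff, chernoffCoeff, Finset.mul_sum]
  refine Finset.sum_le_sum fun y _ => ?_
  calc w y ^ α * q y ^ (1 - α) ≤ w y ^ α * (c * q' y) ^ (1 - α) :=
        mul_le_mul_of_nonneg_left (Real.rpow_le_rpow (hq y) (hqq' y) (sub_nonneg.2 hα))
          (Real.rpow_nonneg (hw y) α)
    _ = c ^ (1 - α) * (w y ^ α * q' y ^ (1 - α)) := by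
        rw [Real.mul_rpow hc (hq' y)]
        ring

lemma coe_mul_log_le_renyiDiv {b : ℝ} (hα : α < 1) (hwq : chernoffCoeff α w q ≤ b) :
    ((1 / (α - 1) * Real.log b : ℝ) : EReal) ≤ renyiDiv α w q := by
  have hneg : 1 / (α - 1) < 0 := one_div_neg.2 (sub_neg.2 hα)
  rw [renyiDiv, if_neg hα.ne, if_pos (Or.inl hα), ← chernoffCoeff]
  rcases le_or_gt (chernoffCoeff α w q) 0 with hZ | hZ
  · rw [ENNReal.ofReal_of_nonpos hZ, ENNReal.log_zero, EReal.coe_mul_bot_of_neg hneg]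
    exact le_top
  · rw [ENNReal.log_ofReal_of_pos hZ, ← EReal.coe_mul, EReal.coe_le_coe_iff]
    exact mul_le_mul_of_nonpos_left (Real.log_le_log hZ hwq) hneg.le

lemma coe_renyiExponent_div_sub_log_le_renyiDiv (hs : 0 < s) (hc : 0 < c)
    (hw : w ∈ stdSimplex ℝ Y) (hq : ∀ y, 0 ≤ q y) (hq' : ∀ y, 0 < q' y)
    (hqq' : ∀ y, q y ≤ c * q' y) :
    ((renyiExponent s w q' / s - Real.log c : ℝ) : EReal) ≤ renyiDiv (1 + s)⁻¹ w q := by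
  have hα : (1 + s)⁻¹ < 1 := inv_lt_one_of_one_lt₀ (by linarith)
  have hcα : 0 < c ^ (1 - (1 + s)⁻¹) := Real.rpow_pos_of_pos hc _
  have hZ' := chernoffCoeff_pos (α := (1 + s)⁻¹) hw hq'
  refine le_of_eq_of_le ?_ (coe_mul_log_le_renyiDiv hα
    (chernoffCoeff_le_of_le_mul hα.le hc.le hw.1 hq (fun y => (hq' y).le) hqq'))
  have hcoeff : 1 / ((1 + s)⁻¹ - 1) = -((1 + s) / s) := by
    have : (1 + s)⁻¹ - 1 = -(s / (1 + s)) := by field_simp; ring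
    rw [this, one_div, inv_neg, inv_div]
  rw [EReal.coe_eq_coe_iff, hcoeff, Real.log_mul hcα.ne' hZ'.ne', Real.log_rpow hc, renyiExponent]
  field_simp
  ring

variable [Fintype X] {W : X → Y → ℝ} {p : X → ℝ}

lemma coe_meanExponent_div_sub_log_le (hs : 0 < s) (hc : 0 < c) (hW : IsChannel W)
    (hp : p ∈ stdSimplex ℝ X) (hq : ∀ y, 0 ≤ q y) (hq' : ∀ y, 0 < q' y)
    (hqq' : ∀ y, q y ≤ c * q' y) :
    ((meanExponent W p s q' / s - Real.log c : ℝ) : EReal) ≤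
      ∑ x, (p x : EReal) * renyiDiv (1 + s)⁻¹ (W x) q := by
  have hsum : meanExponent W p s q' / s - Real.log c =
      ∑ x, p x * (renyiExponent s (W x) q' / s - Real.log c) := by
    simp only [meanExponent, mul_sub, Finset.sum_sub_distrib, ← Finset.sum_mul, hp.2, one_mul,
      Finset.sum_div, mul_div_assoc]
  have hcoe := map_sum (⟨⟨Real.toEReal, EReal.coe_zero⟩, EReal.coe_add⟩ : ℝ →+ EReal)
    (fun x => p x * (renyiExponent s (W x) q' / s - Real.log c)) Finset.univ
  rw [hsum]
  refine hcoe.trans_le (Finset.sum_le_sum fun x _ => (EReal.coe_mul _ _).trans_le ?_)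
  exact mul_le_mul_of_nonneg_left
    (coe_renyiExponent_div_sub_log_le_renyiDiv hs hc (hW x) hq hq' hqq')
    (EReal.coe_nonneg.2 (hp.1 x))

lemma exp_neg_mul_renyiDiv_le (hs : s ∈ Set.Icc (0 : ℝ) 1) (hc : 1 ≤ c) (hW : IsChannel W)
    (hp : p ∈ stdSimplex ℝ X) (hq : ∀ y, 0 ≤ q y) (hq' : ∀ y, 0 < q' y)
    (hqq' : ∀ y, q y ≤ c * q' y) (n : ℕ) (r : ℝ) :
    EReal.exp (-(((n * s : ℝ) : EReal) *
        ((∑ x, (p x : EReal) * renyiDiv (1 + s)⁻¹ (W x) q) - (r : EReal)))) ≤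
      ENNReal.ofReal (c ^ n * Real.exp (-(n * (meanExponent W p s q' - s * r)))) := by
  rcases hs.1.eq_or_lt with rfl | hs₀
  · have hzero : meanExponent W p 0 q' = 0 := Finset.sum_eq_zero fun x _ => by
      rw [renyiExponent_zero (hW x), mul_zero]
    simpa [hzero] using one_le_pow₀ hc
  have hc₀ : 0 < c := one_pos.trans_le hc
  have hreal : ((n * s * (meanExponent W p s q' / s - Real.log c - r) : ℝ) : EReal) ≤
      ((n * s : ℝ) : EReal) *
        ((∑ x, (p x : EReal) * renyiDiv (1 + s)⁻¹ (W x) q) - (r : EReal)) := by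
    rw [EReal.coe_mul, EReal.coe_sub]
    exact mul_le_mul_of_nonneg_left (EReal.sub_le_sub
      (coe_meanExponent_div_sub_log_le hs₀ hc₀ hW hp hq hq' hqq') le_rfl)
        (EReal.coe_nonneg.2 (by positivity))
  refine (EReal.exp_monotone (EReal.neg_le_neg_iff.2 hreal)).trans ?_
  rw [← EReal.coe_neg, EReal.exp_coe]
  refine ENNReal.ofReal_le_ofReal ?_
  have hcn : c ^ n = Real.exp (n * Real.log c) := by rw [Real.exp_nat_mul, Real.exp_log hc₀]
  rw [hcn, ← Real.exp_add, Real.exp_le_exp]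
  have hlog : n * (s * Real.log c) ≤ n * Real.log c :=
    mul_le_mul_of_nonneg_left (mul_le_of_le_one_left (Real.log_nonneg hc) hs.2) n.cast_nonneg
  have hcancel : n * s * (meanExponent W p s q' / s - Real.log c - r) =
      n * (meanExponent W p s q' - s * r) - n * (s * Real.log c) := by
    field_simp
    ring
  linarith

end RenyiDivergence

section FloorSimplex

variable {X Y : Type*} [Fintype Y]

/-- The distributions on `Y` all of whose probabilities are at least `κ`. On this compact convex
set relative entropies are finite and the exponents are continuous. -/
def floorSimplex (Y : Type*) [Fintype Y] (κ : ℝ) : Set (Y → ℝ) :=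
  stdSimplex ℝ Y ∩ Set.Ici fun _ => κ

lemma convex_floorSimplex (κ : ℝ) : Convex ℝ (floorSimplex Y κ) :=
  (convex_stdSimplex ℝ Y).inter (convex_Ici _)

lemma isCompact_floorSimplex (κ : ℝ) : IsCompact (floorSimplex Y κ) :=
  (isCompact_stdSimplex ℝ Y).inter_right isClosed_Ici

/-- The distribution `(q + η) / (1 + η|Y|)` is a mixture of `q` and the uniform distribution. -/
lemma exists_mem_floorSimplex_le_mul {η : ℝ} (hη : 0 < η) {q : Y → ℝ} (hq : q ∈ stdSimplex ℝ Y) :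
    ∃ q' ∈ floorSimplex Y (η / (1 + η * Fintype.card Y)),
      ∀ y, q y ≤ (1 + η * Fintype.card Y) * q' y := by
  have hc : 0 < 1 + η * Fintype.card Y := by positivity
  refine ⟨fun y => (q y + η) / (1 + η * Fintype.card Y), ⟨⟨fun y => ?_, ?_⟩, fun y => ?_⟩,
    fun y => ?_⟩
  · exact div_nonneg (add_nonneg (hq.1 y) hη.le) hc.le
  · rw [← Finset.sum_div, Finset.sum_add_distrib, hq.2, Finset.sum_const, Finset.card_univ,
      nsmul_eq_mul, mul_comm (Fintype.card Y : ℝ) η, div_self hc.ne']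
  · exact div_le_div_of_nonneg_right (le_add_of_nonneg_left (hq.1 y)) hc.le
  · rw [mul_div_cancel₀ _ hc.ne']
    exact le_add_of_nonneg_right hη.le

variable [Fintype X] {W : X → Y → ℝ} {p : X → ℝ} {η s : ℝ}

lemma optExp_le_of_forall_floorSimplex {b r : ℝ} {n : ℕ} (hη : 0 < η) (hW : IsChannel W)
    (hp : p ∈ stdSimplex ℝ X) (hs : s ∈ Set.Icc (0 : ℝ) 1)
    (hb : ∀ q ∈ floorSimplex Y (η / (1 + η * Fintype.card Y)),
      b ≤ meanExponent W p s q - s * r) :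
    optExp W n r ≤
      ENNReal.ofReal ((1 + η * Fintype.card Y) ^ n * Real.exp (-(n * b))) := by
  have hs' : 0 < 1 + s := by linarith [hs.1]
  have hα : (1 + s)⁻¹ ∈ Set.Icc (1 / 2 : ℝ) 1 := by
    refine ⟨?_, inv_le_one_of_one_le₀ (by linarith [hs.1])⟩
    rw [one_div]
    exact inv_anti₀ hs' (by linarith [hs.2])
  have hparam : (1 - (1 + s)⁻¹) / (1 + s)⁻¹ = s := by
    field_simp
    ring
  refine (iInf₂_le _ hα).trans ((iInf₂_le p hp).trans (iSup₂_le fun q hq => ?_))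
  obtain ⟨q', hq', hqq'⟩ := exists_mem_floorSimplex_le_mul hη hq
  have hκ : 0 < η / (1 + η * Fintype.card Y) := by positivity
  rw [hparam]
  refine (exp_neg_mul_renyiDiv_le hs (le_add_of_nonneg_right (by positivity)) hW hp hq.1
    (fun y => hκ.trans_le (hq'.2 y)) hqq' n r).trans (ENNReal.ofReal_le_ofReal ?_)
  have := hb q' hq'
  gcongr

lemma exists_optExp_le (hη : 0 < η) (hW : IsChannel W) (hp : p ∈ stdSimplex ℝ X) (n : ℕ)
    (r : ℝ) :
    ∃ q ∈ floorSimplex Y (η / (1 + η * Fintype.card Y)), ∀ s ∈ Set.Icc (0 : ℝ) 1,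
      optExp W n r ≤ ENNReal.ofReal ((1 + η * Fintype.card Y) ^ n *
        Real.exp (-(n * (meanExponent W p s q - s * r)))) := by
  have hκ : 0 < η / (1 + η * Fintype.card Y) := by positivity
  have hne : (floorSimplex Y (η / (1 + η * Fintype.card Y))).Nonempty := by
    obtain ⟨x, -, -⟩ : ∃ x ∈ Finset.univ, 0 < p x := Finset.exists_lt_of_sum_lt (by simp [hp.2])
    obtain ⟨q, hq, -⟩ := exists_mem_floorSimplex_le_mul hη (hW x)
    exact ⟨q, hq⟩
  obtain ⟨q, hq, s₀, hs₀, hsaddle⟩ := exists_isSaddlePointOn_meanExponent hW hp.1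
    (convex_floorSimplex _) (isCompact_floorSimplex _) hne
    (fun q hq y => hκ.trans_le (hq.2 y)) r
  exact ⟨q, hq, fun s hs => optExp_le_of_forall_floorSimplex hη hW hp hs₀ fun q' hq' =>
    hsaddle q' hq' s hs⟩

end FloorSimplex

section Simulation

variable {X Y : Type*} [Fintype Y] {W V : X → Y → ℝ} {M : ℝ} {q : Y → ℝ}

lemma exists_mem_stdSimplex_between {u b : Y → ℝ} (hu : ∀ y, 0 ≤ u y) (hub : ∀ y, u y ≤ b y)
    (hu₁ : ∑ y, u y ≤ 1) (hb₁ : 1 ≤ ∑ y, b y) :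
    ∃ v ∈ stdSimplex ℝ Y, (∀ y, u y ≤ v y) ∧ ∀ y, v y ≤ b y := by
  obtain ⟨θ, ⟨hθ₀, hθ₁⟩, hθ⟩ := intermediate_value_Icc (zero_le_one (α := ℝ))
    (f := fun θ => ∑ y, (u y + θ * (b y - u y))) (by fun_prop)
    (show (1 : ℝ) ∈ Set.Icc _ _ from ⟨by simpa using hu₁, by simpa using hb₁⟩)
  have hle : ∀ y, u y ≤ u y + θ * (b y - u y) := fun y =>
    le_add_of_nonneg_right (mul_nonneg hθ₀ (sub_nonneg.2 (hub y)))
  refine ⟨fun y => u y + θ * (b y - u y), ⟨fun y => (hu y).trans (hle y), hθ⟩, hle, fun y => ?_⟩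
  linarith [mul_le_of_le_one_left (sub_nonneg.2 (hub y)) hθ₁]

lemma purifiedDist_le_one_sub_half_fidelity {p : Y → ℝ} (hp : p ∈ stdSimplex ℝ Y)
    (hq : q ∈ stdSimplex ℝ Y) : purifiedDist p q ≤ 1 - fidelity p q / 2 := by
  have hF := fidelity_le_one hp hq
  exact Real.sqrt_le_iff.2 ⟨by linarith, by linarith [sq_nonneg (fidelity p q)]⟩

lemma nsError_le_channelPurifiedDist (hV : IsChannel V) (hq : q ∈ stdSimplex ℝ Y)
    (hVq : ∀ x y, V x y ≤ M * q y) : nsError W M ≤ channelPurifiedDist W V := by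
  refine csInf_le ⟨0, ?_⟩ ⟨V, q, hV, hq, hVq, rfl⟩
  rintro _ ⟨V', q', -, -, -, rfl⟩
  exact Real.iSup_nonneg fun x => Real.sqrt_nonneg _

lemma half_le_one_sub_nsError [Nonempty X] {c : ℝ} (hW : IsChannel W) (hM : 1 ≤ M)
    (hq : q ∈ stdSimplex ℝ Y)
    (h : ∀ x, ∃ t ∈ stdSimplex ℝ Y, c ≤ fidelity (W x) (t ⊓ M • q)) :
    c / 2 ≤ 1 - nsError W M := by
  have hcompl : ∀ x, ∃ v ∈ stdSimplex ℝ Y, (∀ y, v y ≤ M * q y) ∧ c ≤ fidelity (W x) v := by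
    intro x
    obtain ⟨t, ht, hc⟩ := h x
    obtain ⟨v, hv, htv, hvq⟩ := exists_mem_stdSimplex_between (u := t ⊓ M • q) (b := M • q)
      (fun y => le_min (ht.1 y) (mul_nonneg (zero_le_one.trans hM) (hq.1 y)))
      (fun y => min_le_right _ _)
      ((Finset.sum_le_sum fun y _ => min_le_left (t y) _).trans_eq ht.2)
      (by simpa [← Finset.mul_sum, hq.2] using hM)
    exact ⟨v, hv, hvq, hc.trans (fidelity_mono_right htv)⟩
  choose V hV hVq hVc using hcompl
  have hdist : channelPurifiedDist W V ≤ 1 - c / 2 := ciSup_le fun x => by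
    linarith [purifiedDist_le_one_sub_half_fidelity (hW x) (hV x), hVc x]
  linarith [nsError_le_channelPurifiedDist (W := W) hV hq hVq]

end Simulation

section UniformMixture

variable {K Ω : Type*} [Fintype K] {Q : K → Ω → ℝ}

/-- The mixture of finitely many distributions with equal weights. -/
def uniformMixture (Q : K → Ω → ℝ) : Ω → ℝ :=
  (Fintype.card K : ℝ)⁻¹ • ∑ k, Q k

lemma uniformMixture_mem_stdSimplex [Fintype Ω] [Nonempty K] (hQ : ∀ k, Q k ∈ stdSimplex ℝ Ω) :
    uniformMixture Q ∈ stdSimplex ℝ Ω := by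
  rw [uniformMixture, Finset.smul_sum]
  exact (convex_stdSimplex ℝ Ω).sum_mem (fun _ _ => by positivity) (by simp) fun k _ => hQ k

lemma inv_card_mul_le_uniformMixture (hQ : ∀ k ω, 0 ≤ Q k ω) (k : K) (ω : Ω) :
    (Fintype.card K : ℝ)⁻¹ * Q k ω ≤ uniformMixture Q ω := by
  simp only [uniformMixture, Pi.smul_apply, Finset.sum_apply, smul_eq_mul]
  gcongr
  exact Finset.single_le_sum (fun k _ => hQ k ω) (Finset.mem_univ k)

lemma inv_card_mul_fidelity_le_uniformMixture [Fintype Ω] {t : Ω → ℝ} {M : ℝ} (p : Ω → ℝ)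
    (ht : ∀ ω, 0 ≤ t ω) (hM : 0 ≤ M) (hQ : ∀ k ω, 0 ≤ Q k ω) (k : K) :
    (Fintype.card K : ℝ)⁻¹ * fidelity p (t ⊓ M • Q k) ≤
      fidelity p (t ⊓ M • uniformMixture Q) := by
  have hcard : (0 : ℝ) ≤ (Fintype.card K : ℝ)⁻¹ := by positivity
  rw [← fidelity_smul_right hcard]
  refine fidelity_mono_right fun ω => le_min ?_ ?_
  · exact (mul_le_mul_of_nonneg_left (min_le_left _ _) hcard).trans
      (mul_le_of_le_one_left (ht ω) (Nat.cast_inv_le_one _))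
  · calc (Fintype.card K : ℝ)⁻¹ * min (t ω) (M * Q k ω)
        ≤ (Fintype.card K : ℝ)⁻¹ * (M * Q k ω) :=
          mul_le_mul_of_nonneg_left (min_le_right _ _) hcard
      _ = M * ((Fintype.card K : ℝ)⁻¹ * Q k ω) := mul_left_comm _ _ _
      _ ≤ M * uniformMixture Q ω :=
          mul_le_mul_of_nonneg_left (inv_card_mul_le_uniformMixture hQ k ω) hM

end UniformMixture

section LetterCount

variable {X : Type*} {n : ℕ}

open Classical in
/-- The type of a word, recorded as the number of occurrences of each letter. -/
def letterCount (x : Fin n → X) (a : X) : Fin (n + 1) :=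
  ⟨(Finset.univ.filter fun i => x i = a).card,
    Nat.lt_succ_of_le ((Finset.card_filter_le _ _).trans_eq (Finset.card_fin n))⟩

variable [Fintype X]

lemma sum_letterCount_mul (x : Fin n → X) (f : X → ℝ) :
    ∑ a, ((letterCount x a : ℕ) : ℝ) * f a = ∑ i, f (x i) := by
  classical
  rw [← Finset.sum_fiberwise Finset.univ x fun i => f (x i)]
  refine Finset.sum_congr rfl fun a _ => ?_
  rw [Finset.sum_congr rfl fun i hi => by rw [(Finset.mem_filter.1 hi).2], Finset.sum_const,
    nsmul_eq_mul]
  simp [letterCount]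

lemma exists_letterCount_eq_mul [Nonempty X] (x : Fin n → X) :
    ∃ p ∈ stdSimplex ℝ X, ∀ a, ((letterCount x a : ℕ) : ℝ) = n * p a := by
  classical
  rcases n.eq_zero_or_pos with rfl | hn
  · exact ⟨_, single_mem_stdSimplex ℝ (Classical.arbitrary X), fun a => by simp⟩
  · have hn' : (n : ℝ) ≠ 0 := by positivity
    refine ⟨fun a => (letterCount x a : ℕ) / n, ⟨fun a => by positivity, ?_⟩, fun a => ?_⟩
    · rw [← Finset.sum_div, div_eq_one_iff_eq hn']
      simpa using sum_letterCount_mul x fun _ => 1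
    · exact (mul_div_cancel₀ _ hn').symm

lemma gammaN_le_inv_card_range_letterCount [Nonempty X]
    [Fintype (Set.range (letterCount (X := X) (n := n)))] :
    gammaN X n ≤ (Fintype.card (Set.range (letterCount (X := X) (n := n))) : ℝ)⁻¹ := by
  classical
  have hcard := Fintype.card_subtype_le fun c => c ∈ Set.range (letterCount (X := X) (n := n))
  rw [Fintype.card_fun, Fintype.card_fin] at hcard
  refine inv_anti₀ (Nat.cast_pos.2 Fintype.card_pos) ?_
  exact_mod_cast (Fintype.card_congr (Equiv.refl _)).trans_le hcard

end LetterCount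

section Achievability

variable {X Y : Type*} [Fintype X] [Fintype Y] {W : X → Y → ℝ} {p : X → ℝ} {q : Y → ℝ} {η : ℝ}
  {n : ℕ}

lemma sum_renyiExponent_eq_mul_meanExponent {x : Fin n → X}
    (hx : ∀ a, ((letterCount x a : ℕ) : ℝ) = n * p a) (s : ℝ) :
    ∑ i, renyiExponent s (W (x i)) q = n * meanExponent W p s q := by
  rw [← sum_letterCount_mul x fun a => renyiExponent s (W a) q, meanExponent, Finset.mul_sum]
  exact Finset.sum_congr rfl fun a _ => by rw [hx, mul_assoc]

/-- The factor by which, for inputs of one fixed type, the fidelity may fall short of `optExp`: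
the exponential bounds the fluctuation of the log-likelihood ratios, the power is the price of
replacing the output distribution by one in `floorSimplex Y (η / (1 + η|Y|))`. -/
def fidelityFactor (Y : Type*) [Fintype Y] (η : ℝ) (n : ℕ) : ℝ :=
  Real.exp (-√((Real.log (η / (1 + η * Fintype.card Y)) ^ 2 + 4) * n)) *
    ((1 + η * Fintype.card Y) ^ n)⁻¹

lemma fidelityFactor_nonneg (hη : 0 ≤ η) (n : ℕ) : 0 ≤ fidelityFactor Y η n := by
  unfold fidelityFactor
  positivity

lemma exists_fidelityFactor_mul_optExp_le_fidelity (hη : 0 < η) (hW : IsChannel W)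
    (hp : p ∈ stdSimplex ℝ X) (n : ℕ) (r : ℝ) :
    ∃ q ∈ stdSimplex ℝ Y, ∀ x : Fin n → X, (∀ a, ((letterCount x a : ℕ) : ℝ) = n * p a) →
      ∃ t ∈ stdSimplex ℝ (Fin n → Y), fidelityFactor Y η n * (optExp W n r).toReal ≤
        fidelity (tensorPower W n x) (t ⊓ Real.exp (n * r) • prodDist fun _ => q) := by
  have hκ : 0 < η / (1 + η * Fintype.card Y) := by positivity
  obtain ⟨q, hq, hopt⟩ := exists_optExp_le hη hW hp n r
  refine ⟨q, hq.1, fun x hx => ?_⟩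
  obtain ⟨s, hs, t, ht, hfid⟩ := exists_exp_neg_renyiExponent_le_fidelity
    (fun i => hW (x i)) hκ hq.1 hq.2 (n * r)
  refine ⟨t, ht, le_trans ?_ hfid⟩
  rw [sum_renyiExponent_eq_mul_meanExponent hx, Fintype.card_fin]
  calc fidelityFactor Y η n * (optExp W n r).toReal
      ≤ fidelityFactor Y η n * ((1 + η * Fintype.card Y) ^ n *
          Real.exp (-(n * (meanExponent W p s q - s * r)))) :=
        mul_le_mul_of_nonneg_left (ENNReal.toReal_le_of_le_ofReal (by positivity) (hopt s hs))
          (fidelityFactor_nonneg hη.le n)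
    _ = Real.exp (-√((Real.log (η / (1 + η * Fintype.card Y)) ^ 2 + 4) * n)) *
          Real.exp (-(n * (meanExponent W p s q - s * r))) := by
        rw [fidelityFactor]
        field_simp
    _ = _ := by
        rw [← Real.exp_add, mul_comm _ (n : ℝ)]
        ring_nf

variable [Nonempty X]

lemma optExp_ne_top (hW : IsChannel W) (n : ℕ) (r : ℝ) : optExp W n r ≠ ⊤ := by
  classical
  obtain ⟨q, -, hq⟩ := exists_optExp_le one_pos hW
    (single_mem_stdSimplex ℝ (Classical.arbitrary X)) n r
  exact ((hq 0 (Set.left_mem_Icc.2 zero_le_one)).trans_lt ENNReal.ofReal_lt_top).ne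

lemma gammaN_mul_fidelityFactor_mul_optExp_half_le {r : ℝ} (hη : 0 < η) (hW : IsChannel W)
    (hr : 0 ≤ r) (n : ℕ) :
    gammaN X n * (fidelityFactor Y η n * (optExp W n r).toReal) / 2 ≤
      1 - nsError (tensorPower W n) (Real.exp (n * r)) := by
  classical
  have htype : ∀ c : Set.range (letterCount (X := X) (n := n)),
      ∃ p ∈ stdSimplex ℝ X, ∀ a, ((c.1 a : ℕ) : ℝ) = n * p a := by
    rintro ⟨_, x, rfl⟩
    exact exists_letterCount_eq_mul x
  choose p hp hcount using htype
  choose q hq hfid using fun c =>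
    exists_fidelityFactor_mul_optExp_le_fidelity hη hW (hp c) n r
  have hQ : ∀ c, prodDist (fun _ => q c) ∈ stdSimplex ℝ (Fin n → Y) := fun c =>
    prodDist_mem_stdSimplex fun _ => hq c
  refine half_le_one_sub_nsError (fun x => prodDist_mem_stdSimplex fun i => hW (x i))
    (Real.one_le_exp (by positivity)) (uniformMixture_mem_stdSimplex hQ) fun x => ?_
  obtain ⟨t, ht, hle⟩ := hfid ⟨_, x, rfl⟩ x (hcount ⟨_, x, rfl⟩)
  refine ⟨t, ht, le_trans ?_ (inv_card_mul_fidelity_le_uniformMixture _ ht.1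
    (Real.exp_pos _).le (fun c => (hQ c).1) ⟨_, x, rfl⟩)⟩
  exact mul_le_mul gammaN_le_inv_card_range_letterCount hle
    (mul_nonneg (fidelityFactor_nonneg hη.le n) ENNReal.toReal_nonneg) (by positivity)

lemma ofReal_mul_optExp_le_one_sub_nsError {r c : ℝ} (hη : 0 < η) (hW : IsChannel W)
    (hr : 0 ≤ r) (hc : c ≤ gammaN X n / 2 * fidelityFactor Y η n) :
    ENNReal.ofReal c * optExp W n r ≤
      ENNReal.ofReal (1 - nsError (tensorPower W n) (Real.exp (n * r))) := by
  rw [← ENNReal.ofReal_toReal (optExp_ne_top hW n r),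
    ← ENNReal.ofReal_mul' ENNReal.toReal_nonneg]
  refine ENNReal.ofReal_le_ofReal ((mul_le_mul_of_nonneg_right hc ENNReal.toReal_nonneg).trans ?_)
  linarith [gammaN_mul_fidelityFactor_mul_optExp_half_le hη hW hr n]

end Achievability

section Prefactors

variable {X Y : Type*} [Fintype Y] {n : ℕ}

lemma sqrt_log_sq_add_four_mul_le_sqrt_constA (η : ℝ) (W : X → Y → ℝ) (n : ℕ) :
    √((Real.log (η / (1 + η * Fintype.card Y)) ^ 2 + 4) * n) ≤ √(constA η W * n) := by
  refine Real.sqrt_le_sqrt (mul_le_mul_of_nonneg_right ?_ n.cast_nonneg)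
  have := le_max_right (Real.log (minProb W) ^ 2)
    (Real.log (η / (1 + η * Fintype.card Y)) ^ 2)
  rw [constA]
  linarith [sq_nonneg (Real.log (Fintype.card Y))]

lemma gammaN_sq_div_mul_exp_le [Fintype X] {η : ℝ} (hη : 0 < η) (W : X → Y → ℝ) (n : ℕ) :
    gammaN X n ^ 2 / 8 * Real.exp (-4 * √(constA η W * n)) * ((1 + η * Fintype.card Y) ^ n)⁻¹ ≤
      gammaN X n / 2 * fidelityFactor Y η n := by
  have hγ : 0 ≤ gammaN X n := by unfold gammaN; positivity
  have hγ₁ : gammaN X n ≤ 1 :=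
    inv_le_one_of_one_le₀ (one_le_pow₀ (le_add_of_nonneg_left n.cast_nonneg))
  rw [fidelityFactor, ← mul_assoc]
  gcongr ?_ * Real.exp ?_ * _
  · linarith [pow_le_of_le_one hγ hγ₁ two_ne_zero]
  · linarith [sqrt_log_sq_add_four_mul_le_sqrt_constA η W n, Real.sqrt_nonneg (constA η W * n)]

lemma one_le_two_mul_log (hn : 2 ≤ n) : 1 ≤ 2 * Real.log n := by
  have := Real.log_le_log two_pos (by exact_mod_cast hn : (2 : ℝ) ≤ n)
  linarith [Real.log_two_gt_d9]

lemma exp_neg_mul_log_le_gammaN_div_two [Fintype X] (hn : 2 ≤ n) :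
    Real.exp (-((2 * Fintype.card X + 1) * Real.log n)) ≤ gammaN X n / 2 := by
  have hn' : (2 : ℝ) ≤ n := by exact_mod_cast hn
  have hexp : Real.exp ((2 * Fintype.card X + 1) * Real.log n) =
      ((n : ℝ) ^ 2) ^ Fintype.card X * n := by
    rw [← pow_mul, ← pow_succ, ← Real.exp_log (show (0 : ℝ) < n by linarith), ← Real.exp_nat_mul,
      Real.log_exp]
    push_cast
    rfl
  rw [Real.exp_neg, hexp, gammaN, div_eq_mul_inv, ← mul_inv]
  gcongr
  nlinarith

lemma one_add_one_div_mul_pow_le_exp {k : ℝ} (hk : 0 ≤ k) (hn : n ≠ 0) :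
    (1 + 1 / n * k) ^ n ≤ Real.exp k :=
  calc (1 + 1 / n * k) ^ n ≤ Real.exp (1 / n * k) ^ n := by
        gcongr
        rw [add_comm]
        exact Real.add_one_le_exp _
    _ = Real.exp k := by
        rw [← Real.exp_nat_mul]
        field_simp

lemma sqrt_log_sq_add_four_mul_le (hn : 2 ≤ n) :
    √((Real.log (1 / n / (1 + 1 / n * Fintype.card Y)) ^ 2 + 4) * n) ≤
      (2 * Real.log (1 + Fintype.card Y) + 5) * (√n * Real.log n) := by
  have hn' : (2 : ℝ) ≤ n := by exact_mod_cast hn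
  have hL := one_le_two_mul_log hn
  have hκ : Real.log (1 / n / (1 + 1 / n * Fintype.card Y)) = -Real.log (n + Fintype.card Y) := by
    rw [← Real.log_inv]
    congr 1
    field_simp
  have hlog : Real.log (n + Fintype.card Y) ≤ Real.log n + Real.log (1 + Fintype.card Y) := by
    rw [← Real.log_mul (by positivity) (by positivity)]
    refine Real.log_le_log (by positivity) ?_
    nlinarith [(Fintype.card Y).cast_nonneg (α := ℝ)]
  have hlog₀ : 0 ≤ Real.log (n + Fintype.card Y) :=
    Real.log_nonneg (by linarith [(Fintype.card Y).cast_nonneg (α := ℝ)])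
  have hlogY : 0 ≤ Real.log (1 + Fintype.card Y) :=
    Real.log_nonneg (le_add_of_nonneg_right (Nat.cast_nonneg _))
  calc √((Real.log (1 / n / (1 + 1 / n * Fintype.card Y)) ^ 2 + 4) * n)
      = √(Real.log (n + Fintype.card Y) ^ 2 + 4) * √n := by
        rw [Real.sqrt_mul (by positivity), hκ, neg_sq]
    _ ≤ (Real.log n + Real.log (1 + Fintype.card Y) + 2) * √n := by
        refine mul_le_mul_of_nonneg_right (Real.sqrt_le_iff.2 ⟨?_, ?_⟩) (Real.sqrt_nonneg _) <;>
        nlinarith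
    _ ≤ (2 * Real.log (1 + Fintype.card Y) + 5) * Real.log n * √n := by
        refine mul_le_mul_of_nonneg_right ?_ (Real.sqrt_nonneg _)
        nlinarith
    _ = _ := by ring

lemma exp_neg_le_fidelityFactor (hn : 2 ≤ n) :
    Real.exp (-((2 * Real.log (1 + Fintype.card Y) + 5) * (√n * Real.log n) + Fintype.card Y)) ≤
      fidelityFactor Y (1 / n) n := by
  rw [fidelityFactor, neg_add, Real.exp_add, Real.exp_neg (Fintype.card Y : ℝ)]
  gcongr
  · exact sqrt_log_sq_add_four_mul_le hn
  · exact one_add_one_div_mul_pow_le_exp (Nat.cast_nonneg _) (two_pos.trans_le hn).ne'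

lemma exists_exp_neg_sqrt_mul_log_le (X Y : Type*) [Fintype X] [Fintype Y] :
    ∃ C : ℝ, 0 < C ∧ ∀ n : ℕ, 2 ≤ n → Real.exp (-(C * (√n * Real.log n))) ≤
      gammaN X n / 2 * fidelityFactor Y (1 / n) n := by
  have hlogY : 0 ≤ Real.log (1 + Fintype.card Y) :=
    Real.log_nonneg (le_add_of_nonneg_right (Nat.cast_nonneg _))
  refine ⟨2 * Fintype.card X + 1 + (2 * Real.log (1 + Fintype.card Y) + 5) +
    2 * Fintype.card Y, by positivity, fun n hn => ?_⟩
  have hL := one_le_two_mul_log hn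
  have hlog : Real.log n ≤ √n * Real.log n := le_mul_of_one_le_left (by linarith)
    (Real.one_le_sqrt.2 (by exact_mod_cast (one_le_two.trans hn)))
  refine le_trans ?_ (mul_le_mul (exp_neg_mul_log_le_gammaN_div_two hn)
    (exp_neg_le_fidelityFactor hn) (Real.exp_pos _).le (by unfold gammaN; positivity))
  rw [← Real.exp_add, Real.exp_le_exp]
  have hX := mul_le_mul_of_nonneg_left hlog (by positivity : (0 : ℝ) ≤ 2 * Fintype.card X + 1)
  have hY := mul_le_mul_of_nonneg_left (hL.trans (mul_le_mul_of_nonneg_left hlog two_pos.le))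
    (Fintype.card Y).cast_nonneg (α := ℝ)
  linarith

end Prefactors

end ChannelSim

end

theorem mainTheorem8 {X Y : Type*} [Fintype X] [Nonempty X] [Fintype Y]
    (W : X → Y → ℝ) (hW : ChannelSim.IsChannel W) :
    (∀ (r : ℝ), 0 ≤ r → ∀ (η : ℝ), 0 < η → ∀ (n : ℕ),
      ENNReal.ofReal
          (ChannelSim.gammaN X n ^ 2 / 8 *
            Real.exp (-4 * √(ChannelSim.constA η W * n)) *
            ((1 + η * Fintype.card Y) ^ n)⁻¹) *
          ChannelSim.optExp W n r
        ≤ ENNReal.ofReal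
            (1 - ChannelSim.nsError (ChannelSim.tensorPower W n) (Real.exp (n * r)))) ∧
    (∃ C : ℝ, 0 < C ∧ ∀ (r : ℝ), 0 ≤ r → ∀ (n : ℕ), 2 ≤ n →
      ENNReal.ofReal (Real.exp (-(C * (√n * Real.log n)))) * ChannelSim.optExp W n r
        ≤ ENNReal.ofReal
            (1 - ChannelSim.nsError (ChannelSim.tensorPower W n) (Real.exp (n * r)))) := by
  refine ⟨fun r hr η hη n => ?_, ?_⟩
  · exact ChannelSim.ofReal_mul_optExp_le_one_sub_nsError hη hW hr
      (ChannelSim.gammaN_sq_div_mul_exp_le hη W n)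
  · obtain ⟨C, hC, hbound⟩ := ChannelSim.exists_exp_neg_sqrt_mul_log_le X Y
    refine ⟨C, hC, fun r hr n hn => ?_⟩
    have hη : (0 : ℝ) < 1 / n := one_div_pos.2 (Nat.cast_pos.2 (two_pos.trans_le hn))
    exact ChannelSim.ofReal_mul_optExp_le_one_sub_nsError hη hW hr (hbound n hn)
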